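/- Let $G$ be a finite group, let $Q$ be a normal subgroup of $G$, and let $c\ge 1$ be an integer such that $[Q,{}_cG]=1$, where $[Q,{}_0G]=Q$ and $[Q,{}_{n+1}G]=[[Q,{}_nG],G]$ denote the iterated commutator subgroups. Let $\mathbb{Q}/\mathbb{Z}$ be the trivial $Q$-module and let $$\operatorname{Sha}^2(Q,\mathbb{Q}/\mathbb{Z})=\bigcap_{A\le Q,\ A\text{ abelian}}\ker\bigl(\operatorname{res}^Q_A: H^2(Q,\mathbb{Q}/\mathbb{Z})\to H^2(A,\mathbb{Q}/\mathbb{Z})\bigr)$$ be the Bogomolov multiplier of $Q$. The group $G$ acts on $Q$ from the right by conjugation, $q\cdot g=g^{-1}qg$, and hence acts from the right on $H^2(Q,\mathbb{Q}/\mathbb{Z})$ by sending the class of a $2$-cocycle $\kappa$ to the class of $\kappa g:(q_1,q_2)\mapsto \kappa(gq_1g^{-1},gq_2g^{-1})$. The subgroup $V=\operatorname{Sha}^2(Q,\mathbb{Q}/\mathbb{Z})$ is stable under this action. For a subgroup $N\le V$ let $[N,G]$ be the subgroup of $V$ generated by all $\alpha g-\alpha$ with $\alpha\in N$, $g\in G$,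 and put $[V,{}_0G]=V$, $[V,{}_{n+1}G]=[[V,{}_nG],G]$. Then $[\operatorname{Sha}^2(Q,\mathbb{Q}/\mathbb{Z}),{}_{c-1}G]$ is trivial. -/

import Mathlib

open CategoryTheory

universe u

/-- The iterated commutator subgroup `[X, ₙ Y] = [[…[X, Y], …], Y]` (`n` copies of `Y`),
with `[X, ₀ Y] = X`. -/
def iterCommutator {G : Type*} [Group G] (X Y : Subgroup G) : ℕ → Subgroup G
  | 0 => X
  | n + 1 => ⁅iterCommutator X Y n, Y⁆

/-- `[N, H]` for a subgroup `N` of an `H`-module `V`: the subgroup of `V` generated by all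
`v · h - v` with `v ∈ N` and `h ∈ H`, i.e. (in additive notation) by the commutators `[v, h]`
formed in the semidirect product of `H` and `V`. -/
def moduleCommutator {k H V : Type*} [CommRing k] [Monoid H] [AddCommGroup V] [Module k V]
    (ρ : Representation k H V) (N : AddSubgroup V) : AddSubgroup V :=
  AddSubgroup.closure {x | ∃ v ∈ N, ∃ h : H, x = ρ h v - v}

/-- `[V, ₙ H] = [[…[V, H], …], H]` (`n` copies of `H`) for an `H`-module `V`,
with `[V, ₀ H] = V`. -/
def iterModuleCommutator {k H V : Type*} [CommRing k] [Monoid H] [AddCommGroup V] [Module k V]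
    (ρ : Representation k H V) : ℕ → AddSubgroup V
  | 0 => ⊤
  | n + 1 => moduleCommutator ρ (iterModuleCommutator ρ n)

section Cohomology

variable {k : Type u} [CommRing k]

/-- `Shaⁿ(G, M)`: the classes in `Hⁿ(G, M)` that restrict to zero on every abelian subgroup
of `G`. -/
noncomputable def Sha {G : Type u} [Group G] (n : ℕ) (M : Rep.{u} k G) :
    Submodule k (groupCohomology M n) :=
  ⨅ (A : Subgroup G) (_ : IsMulCommutative A),
    LinearMap.ker (groupCohomology.map (B := Rep.res A.subtype M) A.subtype
      (𝟙 (Rep.res A.subtype M)) n).hom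

variable {Q : Type u} [Group Q] (M : Type u) [AddCommGroup M] [Module k M]

/-- The pullback `f* : Hⁿ(Q, M) → Hⁿ(P, M)` along a group homomorphism `f : P → Q`, for trivial
coefficients `M`; on cochains, `c ↦ c ∘ f`. -/
noncomputable def cohomologyPullback {P : Type u} [Group P] (f : P →* Q) (n : ℕ) :
    groupCohomology (Rep.trivial k Q M) n →ₗ[k] groupCohomology (Rep.trivial k P M) n :=
  (groupCohomology.map (A := Rep.trivial k Q M) (B := Rep.trivial k P M) f
    (Rep.ofHom ⟨LinearMap.id, fun _ => rfl⟩) n).hom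

theorem cohomologyPullback_id (n : ℕ) :
    cohomologyPullback (k := k) M (MonoidHom.id Q) n = LinearMap.id := by
  have h := groupCohomology.map_id (B := Rep.trivial k Q M) n
  exact congrArg ModuleCat.Hom.hom h

theorem cohomologyPullback_comp {P R : Type u} [Group P] [Group R] (f : P →* Q) (g : R →* P)
    (n : ℕ) :
    cohomologyPullback (k := k) M (f.comp g) n =
      cohomologyPullback M g n ∘ₗ cohomologyPullback M f n := by
  have h := groupCohomology.map_comp (A := Rep.trivial k Q M) (B := Rep.trivial k P M)
    (C := Rep.trivial k R M) f g (Rep.ofHom ⟨LinearMap.id, fun _ => rfl⟩)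
    (Rep.ofHom ⟨LinearMap.id, fun _ => rfl⟩) n
  exact congrArg ModuleCat.Hom.hom h

/-- A class lies in `Shaⁿ(Q, M)` iff its pullback along every inclusion of an abelian subgroup
vanishes. -/
theorem mem_Sha_trivial_iff (n : ℕ) (x : groupCohomology (Rep.trivial k Q M) n) :
    x ∈ Sha n (Rep.trivial k Q M) ↔
      ∀ A : Subgroup Q, IsMulCommutative A → cohomologyPullback M A.subtype n x = 0 := by
  simp only [Sha, Submodule.mem_iInf, LinearMap.mem_ker]
  rfl

theorem cohomologyPullback_mem_Sha (e : Q ≃* Q) (n : ℕ)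
    {x : groupCohomology (Rep.trivial k Q M) n} (hx : x ∈ Sha n (Rep.trivial k Q M)) :
    cohomologyPullback M e.toMonoidHom n x ∈ Sha n (Rep.trivial k Q M) := by
  rw [mem_Sha_trivial_iff] at hx ⊢
  intro A hA
  have hB : IsMulCommutative (A.map e.toMonoidHom) := inferInstance
  have h1 : e.toMonoidHom.comp A.subtype =
      (A.map e.toMonoidHom).subtype.comp (e.toMonoidHom.subgroupMap A) := rfl
  rw [← LinearMap.comp_apply, ← cohomologyPullback_comp, h1, cohomologyPullback_comp,
    LinearMap.comp_apply, hx _ hB, map_zero]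

variable {G : Type u} [Group G]

/-- The right action of `G` on `Hⁿ(Q, M)` (`M` a trivial module), i.e. a representation of `Gᵐᵒᵖ`,
induced by an action `θ` of `G` on `Q`: on cochains, `(c · g)(q₁, …, qₙ) = c(q₁g⁻¹, …, qₙg⁻¹)`,
where `q g = θ(g⁻¹)(q)` is the right action of `G` on `Q`, so that `q g⁻¹ = θ(g)(q)`. -/
noncomputable def cohomologyRightRep (θ : G →* MulAut Q) (n : ℕ) :
    Representation k Gᵐᵒᵖ (groupCohomology (Rep.trivial k Q M) n) where
  toFun g := cohomologyPullback M (θ g.unop).toMonoidHom n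
  map_one' := by
    rw [MulOpposite.unop_one, map_one]
    exact cohomologyPullback_id M n
  map_mul' g h := by
    rw [MulOpposite.unop_mul, map_mul]
    exact cohomologyPullback_comp M (θ h.unop).toMonoidHom (θ g.unop).toMonoidHom n

/-- The right action of `G` on the submodule `Shaⁿ(Q, M)` of `Hⁿ(Q, M)`. -/
noncomputable def shaRightRep (θ : G →* MulAut Q) (n : ℕ) :
    Representation k Gᵐᵒᵖ (Sha n (Rep.trivial k Q M)) :=
  (cohomologyRightRep M θ n).subrepresentation (Sha n (Rep.trivial k Q M))
    fun g _ hx => cohomologyPullback_mem_Sha M (θ g.unop) n hx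

end Cohomology

/-- The abelian group `ℚ/ℤ`, lifted to an arbitrary universe. -/
abbrev RatModInt : Type u := ULift.{u} (AddCircle (1 : ℚ))

/-- The ring of integers, lifted to an arbitrary universe: Mathlib's group cohomology wants the
coefficient ring in the universe of the group. (Not reducible, so that the module structures over
it are found unambiguously.) -/
def LiftedInt : Type u := ULift.{u} ℤ

instance : CommRing LiftedInt.{u} := inferInstanceAs (CommRing (ULift.{u} ℤ))

/-- `ℚ/ℤ` with its structure of an abelian group, as a module over the integers. -/
instance : Module LiftedInt.{u} RatModInt.{u} :=
  inferInstanceAs (Module (ULift.{u} ℤ) RatModInt.{u})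

open scoped commutatorElement

/-! Let `F` be the free group on `Q` and `R` the kernel of `F → Q`. Inflated to `F`, a class `a`
becomes the coboundary of a cochain `l`; `l` is a homomorphism on `R`, and `a = 0` once `l|R`
extends to `F`. Since `ℚ/ℤ` is injective, it suffices that `l` kills `R ∩ [F, F]`. If `a` lies in
Sha, then `l` kills every single commutator lying in `R` (`IsInflationCochain.commutator_eq_zero`).
Let `S i` be the preimage of `[Q, ᵢ G]` in `F`, and `C m` the subgroup generated by all `[S i, S j]`
with `i + j = m`. The generators of `C (c - 1)` are commutators in `R`, while `C 0 = [F, F]`.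
Conjugation by `g ∈ G` lifts to `F` and moves elements of `C m` only by elements of `C (m + 1)`. So
if the cochain of `v` kills `R ∩ C (m + 1)`, that of `v · g - v` kills `R ∩ C m`: each commutation
with `G` gains one step, and `c - 1` steps lead to `C 0`. -/

theorem Subgroup.commutator_commutator_le_of_rotate {G : Type*} [Group G]
    {H₁ H₂ H₃ N : Subgroup G} [N.Normal] (h₁ : ⁅⁅H₂, H₃⁆, H₁⁆ ≤ N) (h₂ : ⁅⁅H₃, H₁⁆, H₂⁆ ≤ N) :
    ⁅⁅H₁, H₂⁆, H₃⁆ ≤ N := by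
  rw [← QuotientGroup.ker_mk' N, ← Subgroup.map_eq_bot_iff] at h₁ h₂ ⊢
  simp only [Subgroup.map_commutator] at h₁ h₂ ⊢
  exact Subgroup.commutator_commutator_eq_bot_of_rotate h₁ h₂

section IterCommutator

variable {G : Type*} [Group G] (X : Subgroup G) [X.Normal]

instance iterCommutator_normal : ∀ n, (iterCommutator X ⊤ n).Normal
  | 0 => ‹X.Normal›
  | n + 1 =>
    have := iterCommutator_normal n
    inferInstanceAs (⁅iterCommutator X ⊤ n, (⊤ : Subgroup G)⁆ : Subgroup G).Normal

/-- Three subgroups lemma and induction on `j`; `i` must vary because one rotation replaces `(i, j +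
1)` by `(i + 1, j)`. -/
theorem commutator_iterCommutator_le (i j : ℕ) :
    ⁅iterCommutator X ⊤ i, iterCommutator X ⊤ j⁆ ≤ iterCommutator X ⊤ (i + j + 1) := by
  induction j generalizing i with
  | zero => exact Subgroup.commutator_mono le_rfl le_top
  | succ j ih =>
    rw [Subgroup.commutator_comm]
    refine Subgroup.commutator_commutator_le_of_rotate ?_ ?_
    · rw [Subgroup.commutator_comm ⊤]
      refine (ih (i + 1)).trans_eq ?_
      congr 1
      omega
    · exact Subgroup.commutator_mono (ih i) le_rfl

end IterCommutator

/-! ### Filtration by commutators of given total degree -/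

section CommutatorFiltration

variable {P : Type*} [Group P]

/-- The subgroup generated by the commutators `⁅x, y⁆` with `x ∈ S i`, `y ∈ S j`, `i + j = m`. -/
def commutatorFiltration (S : ℕ → Subgroup P) (m : ℕ) : Subgroup P :=
  Subgroup.closure {w | ∃ i j, i + j = m ∧ ∃ x ∈ S i, ∃ y ∈ S j, ⁅x, y⁆ = w}

theorem commutator_mem_commutatorFiltration {S : ℕ → Subgroup P} {i j m : ℕ} (h : i + j = m)
    {x y : P} (hx : x ∈ S i) (hy : y ∈ S j) : ⁅x, y⁆ ∈ commutatorFiltration S m :=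
  Subgroup.subset_closure ⟨i, j, h, x, hx, y, hy, rfl⟩

theorem commutatorFiltration_normal (S : ℕ → Subgroup P) (hS : ∀ i, (S i).Normal) (m : ℕ) :
    (commutatorFiltration S m).Normal := by
  refine ⟨fun w hw p => ?_⟩
  have : commutatorFiltration S m ≤
      (commutatorFiltration S m).comap (MulAut.conj p).toMonoidHom := by
    refine (Subgroup.closure_le _).2 ?_
    rintro _ ⟨i, j, h, x, hx, y, hy, rfl⟩
    change p * ⁅x, y⁆ * p⁻¹ ∈ commutatorFiltration S m
    rw [conjugate_commutatorElement]
    exact commutator_mem_commutatorFiltration h ((hS i).conj_mem _ hx p) ((hS j).conj_mem _ hy p)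
  exact this hw

theorem commutator_le_commutatorFiltration_zero {S : ℕ → Subgroup P} (h : S 0 = ⊤) :
    commutator P ≤ commutatorFiltration S 0 := by
  rw [commutator_def, Subgroup.commutator_le]
  exact fun x _ y _ =>
    commutator_mem_commutatorFiltration (zero_add 0) (h ▸ Subgroup.mem_top x)
      (h ▸ Subgroup.mem_top y)

/-- An endomorphism that raises the degree in `S` also raises it in the commutator filtration. -/
theorem map_mul_inv_mem_commutatorFiltration {S : ℕ → Subgroup P} (hS : ∀ i, (S i).Normal)
    (hS' : Antitone S) (f : P →* P) (hf : ∀ i, ∀ x ∈ S i, x⁻¹ * f x ∈ S (i + 1)) {m : ℕ} {w : P}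
    (hw : w ∈ commutatorFiltration S m) : f w * w⁻¹ ∈ commutatorFiltration S (m + 1) := by
  set F := commutatorFiltration S (m + 1) with hF
  have hN : F.Normal := commutatorFiltration_normal S hS _
  have key : commutatorFiltration S m ≤
      ((QuotientGroup.mk' F).comp f).eqLocus (QuotientGroup.mk' F) := by
    refine (Subgroup.closure_le _).2 ?_
    rintro _ ⟨i, j, h, x, hx, y, hy, rfl⟩
    obtain ⟨u, hu, hxu⟩ : ∃ u ∈ S (i + 1), f x = x * u := ⟨_, hf i x hx, by group⟩
    obtain ⟨v, hv, hyv⟩ : ∃ v ∈ S (j + 1), f y = y * v := ⟨_, hf j y hy, by group⟩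
    have comm {i' j' : ℕ} {a b : P} (h' : i' + j' = m + 1) (ha : a ∈ S i') (hb : b ∈ S j') :
        Commute (QuotientGroup.mk' F a) (QuotientGroup.mk' F b) := by
      rw [← commutatorElement_eq_one_iff_commute, ← map_commutatorElement]
      exact (QuotientGroup.eq_one_iff _).2 (commutator_mem_commutatorFiltration h' ha hb)
    -- The three error commutators `⁅u, y⁆`, `⁅x, v⁆`, `⁅u, v⁆` all have degree at least `m + 1`, so
    -- they die modulo `F`.
    have h₁ := comm (by omega) hu hy
    have h₂ := comm (by omega) hx hv
    have h₃ := comm (by omega) (hS' (Nat.le_succ i) hu) hv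
    change QuotientGroup.mk' F (f ⁅x, y⁆) = QuotientGroup.mk' F ⁅x, y⁆
    simp only [map_commutatorElement, hxu, hyv, map_mul]
    generalize QuotientGroup.mk' F x = x, QuotientGroup.mk' F y = y, QuotientGroup.mk' F u = u,
      QuotientGroup.mk' F v = v at h₁ h₂ h₃
    have h₄ : ⁅u, y * v⁆ = 1 := (h₁.mul_right h₃).commutator_eq
    rw [commutatorElement_mul_left_eq_conj_mul, h₄, commutatorElement_mul_right_eq_mul_conj,
      h₂.commutator_eq]
    simp
  have := key hw
  rw [← QuotientGroup.ker_mk' F, MonoidHom.mem_ker, map_mul, map_inv, mul_inv_eq_one]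
  exact this

end CommutatorFiltration

/-! ### Classes in `H²` as homomorphisms on the kernel of a presentation -/

section TrivialCoefficients

variable {k : Type u} [CommRing k] {Q : Type u} [Group Q] {M : Type u} [AddCommGroup M] [Module k M]

open groupCohomology

theorem mem_cocycles₂_trivial_iff {z : Q × Q → M} :
    z ∈ cocycles₂ (Rep.trivial k Q M) ↔
      ∀ g h j : Q, z (g * h, j) + z (g, h) = z (h, j) + z (g, h * j) :=
  mem_cocycles₂_iff (A := Rep.trivial k Q M) z

theorem H2π_trivial_eq_zero_iff (z : cocycles₂ (Rep.trivial k Q M)) :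
    H2π (Rep.trivial k Q M) z = 0 ↔
      ∃ m : Q → M, ∀ x y, z.1 (x, y) = m x + m y - m (x * y) := by
  rw [H2π_eq_zero_iff]
  have (m : Q → M) (x y : Q) : m y - m (x * y) + m x = m x + m y - m (x * y) := by abel
  constructor
  · rintro ⟨m, hm⟩
    exact ⟨m, fun x y => (congrFun hm (x, y)).symm.trans (this m x y)⟩
  · rintro ⟨m, hm⟩
    exact ⟨m, funext fun p => (this m p.1 p.2).trans (hm p.1 p.2).symm⟩

theorem cohomologyPullback_H2π {P : Type u} [Group P] (f : P →* Q)
    (z : cocycles₂ (Rep.trivial k Q M)) :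
    ∃ z' : cocycles₂ (Rep.trivial k P M), (∀ x y, z'.1 (x, y) = z.1 (f x, f y)) ∧
      cohomologyPullback M f 2 (H2π (Rep.trivial k Q M) z) = H2π (Rep.trivial k P M) z' :=
  ⟨mapCocycles₂ (A := Rep.trivial k Q M) (B := Rep.trivial k P M) f
    (Rep.ofHom ⟨LinearMap.id, fun _ => rfl⟩) z, fun _ _ => rfl,
    H2π_comp_map_apply (A := Rep.trivial k Q M) (B := Rep.trivial k P M) f
      (Rep.ofHom ⟨LinearMap.id, fun _ => rfl⟩) z⟩

theorem exists_normalized_cocycle₂ (a : groupCohomology (Rep.trivial k Q M) 2) :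
    ∃ z : cocycles₂ (Rep.trivial k Q M), z.1 (1, 1) = 0 ∧ H2π (Rep.trivial k Q M) z = a := by
  induction a using H2_induction_on with | h z => ?_
  let b : cocycles₂ (Rep.trivial k Q M) :=
    -- A constant cocycle is the coboundary of the constant cochain with the same value.
    ⟨fun _ => z.1 (1, 1), mem_cocycles₂_trivial_iff.2 fun _ _ _ => rfl⟩
  refine ⟨z - b, sub_self (z.1 (1, 1)), ?_⟩
  rw [map_sub, sub_eq_self, H2π_trivial_eq_zero_iff]
  exact ⟨fun _ => z.1 (1, 1), fun _ _ => (add_sub_cancel_right _ _).symm⟩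

variable {P : Type u} [Group P]

/-- `l` is a cochain on `P` whose coboundary is the inflation along `π : P → Q` of a normalized
cocycle of class `a`. -/
def IsInflationCochain (π : P →* Q) (l : P → M) (a : groupCohomology (Rep.trivial k Q M) 2) :
    Prop :=
  ∃ z : cocycles₂ (Rep.trivial k Q M), z.1 (1, 1) = 0 ∧ H2π (Rep.trivial k Q M) z = a ∧
    ∀ x y, z.1 (π x, π y) = l x + l y - l (x * y)

namespace IsInflationCochain

variable {π : P →* Q} {l l' : P → M} {a a' : groupCohomology (Rep.trivial k Q M) 2}

theorem zero (π : P →* Q) :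
    IsInflationCochain π (0 : P → M) (0 : groupCohomology (Rep.trivial k Q M) 2) :=
  ⟨0, rfl, map_zero _, fun _ _ => by simp; rfl⟩

theorem add (h : IsInflationCochain π l a) (h' : IsInflationCochain π l' a') :
    IsInflationCochain π (l + l') (a + a') := by
  obtain ⟨z, hz, rfl, hl⟩ := h
  obtain ⟨z', hz', rfl, hl'⟩ := h'
  refine ⟨z + z', ?_, map_add _ _ _, fun x y => ?_⟩
  · exact (congrArg₂ (· + ·) hz hz').trans (add_zero 0)
  · refine (congrArg₂ (· + ·) (hl x y) (hl' x y)).trans ?_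
    simp only [Pi.add_apply]
    abel

theorem neg (h : IsInflationCochain π l a) : IsInflationCochain π (-l) (-a) := by
  obtain ⟨z, hz, rfl, hl⟩ := h
  refine ⟨-z, ?_, map_neg _ _, fun x y => ?_⟩
  · exact (congrArg (- ·) hz).trans neg_zero
  · refine (congrArg (- ·) (hl x y)).trans ?_
    simp only [Pi.neg_apply]
    abel

theorem pullback {Q' P' : Type u} [Group Q'] [Group P'] {π' : P' →* Q'} (e : Q' →* Q)
    (f : P' →* P) (hf : ∀ x, π (f x) = e (π' x)) (h : IsInflationCochain π l a) :
    IsInflationCochain π' (l ∘ f) (cohomologyPullback M e 2 a) := by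
  obtain ⟨z, hz, rfl, hl⟩ := h
  obtain ⟨z', hz', h'⟩ := cohomologyPullback_H2π e z
  refine ⟨z', by rw [hz', map_one, hz], h'.symm, fun x y => ?_⟩
  rw [hz', ← hf, ← hf, hl, ← map_mul]
  rfl

theorem map_mul_of_mem_ker_left (h : IsInflationCochain π l a) {r : P} (hr : r ∈ π.ker) (x : P) :
    l (r * x) = l r + l x := by
  obtain ⟨z, hz, -, hl⟩ := h
  have := hl r x
  rw [MonoidHom.mem_ker.1 hr, show z.1 (1, π x) = z.1 (1, 1) from cocycles₂_map_one_fst z _,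
    hz] at this
  exact (sub_eq_zero.1 this.symm).symm

theorem map_mul_of_mem_ker_right (h : IsInflationCochain π l a) {r : P} (hr : r ∈ π.ker) (x : P) :
    l (x * r) = l x + l r := by
  obtain ⟨z, hz, -, hl⟩ := h
  have := hl x r
  rw [MonoidHom.mem_ker.1 hr, show z.1 (π x, 1) = z.1 (1, 1) from cocycles₂_map_one_snd z _,
    hz] at this
  exact (sub_eq_zero.1 this.symm).symm

/-- The restriction of an inflation cochain to the kernel is a homomorphism. -/
def kerHom (h : IsInflationCochain π l a) : π.ker →* Multiplicative M :=
  MonoidHom.mk' (fun r => Multiplicative.ofAdd (l r)) fun r s => h.map_mul_of_mem_ker_left r.2 s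

theorem map_div_of_mem_ker (h : IsInflationCochain π l a) {r s : P}
    (hr : r ∈ π.ker) (hs : s ∈ π.ker) :
    l (r / s) = l r - l s :=
  map_div h.kerHom ⟨r, hr⟩ ⟨s, hs⟩

/-- The images of `x` and `y` generate an abelian subgroup, on which the cocycle is a coboundary and
hence symmetric. Symmetry at these images says `l (x * y) = l (y * x)`. -/
theorem commutator_eq_zero (h : IsInflationCochain π l a) (ha : a ∈ Sha 2 (Rep.trivial k Q M))
    {x y : P} (hxy : ⁅x, y⁆ ∈ π.ker) : l ⁅x, y⁆ = 0 := by
  obtain ⟨z, hz, rfl, hl⟩ := id h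
  have hc : Commute (π x) (π y) := by
    rwa [← commutatorElement_eq_one_iff_commute, ← map_commutatorElement]
  let A := Subgroup.closure {π x, π y}
  have hA : IsMulCommutative A := Subgroup.isMulCommutative_closure (by
    rintro _ (rfl | rfl) _ (rfl | rfl)
    exacts [rfl, hc, hc.symm, rfl])
  obtain ⟨z', hz', h'⟩ := cohomologyPullback_H2π A.subtype z
  rw [(mem_Sha_trivial_iff M 2 _).1 ha A hA, eq_comm, H2π_trivial_eq_zero_iff] at h'
  obtain ⟨m, hm⟩ := h'
  have hsymm : z.1 (π x, π y) = z.1 (π y, π x) := by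
    let p : A := ⟨π x, Subgroup.subset_closure (by simp)⟩
    let q : A := ⟨π y, Subgroup.subset_closure (by simp)⟩
    have hpq : p * q = q * p := Subtype.ext hc
    rw [show z.1 (π x, π y) = z'.1 (p, q) from (hz' p q).symm,
      show z.1 (π y, π x) = z'.1 (q, p) from (hz' q p).symm, hm, hm, hpq, add_comm (m p)]
  have h₁ := h.map_mul_of_mem_ker_left hxy (y * x)
  rw [show ⁅x, y⁆ * (y * x) = x * y by simp [commutatorElement_def]] at h₁
  rw [hl, hl, h₁, add_comm (l x)] at hsymm
  simpa using hsymm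

/-- A class vanishes if the restriction to the kernel of an inflation cochain extends to a
homomorphism. -/
theorem eq_zero_of_extends (h : IsInflationCochain π l a) (hπ : Function.Surjective π)
    (χ : P →* Multiplicative M) (hχ : ∀ r ∈ π.ker, (χ r).toAdd = l r) : a = 0 := by
  obtain ⟨z, hz, rfl, hl⟩ := id h
  rw [H2π_trivial_eq_zero_iff]
  let s := Function.surjInv hπ
  have hs : ∀ q, π (s q) = q := Function.surjInv_eq hπ
  -- `l - χ` is constant on cosets of the kernel, so it descends to `Q`; `χ` does not change the
  -- coboundary.
  refine ⟨fun q => l (s q) - (χ (s q)).toAdd, fun x y => ?_⟩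
  have hr : (s (x * y))⁻¹ * (s x * s y) ∈ π.ker := by
    rw [MonoidHom.mem_ker, map_mul, map_inv, map_mul, hs, hs, hs, inv_mul_cancel]
  have h₁ := h.map_mul_of_mem_ker_right hr (s (x * y))
  rw [← hχ _ hr, mul_inv_cancel_left] at h₁
  have h₂ := hl (s x) (s y)
  rw [hs, hs] at h₂
  rw [h₂, h₁]
  simp only [map_mul, map_inv, toAdd_mul, toAdd_inv]
  abel

end IsInflationCochain

/-- The underlying set of the central extension of `Q` by `M` defined by a cocycle `z`. -/
@[ext] structure CocycleExtension (z : cocycles₂ (Rep.trivial k Q M)) where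
  /-- The image in `Q`. -/
  base : Q
  /-- The coordinate in `M`. -/
  fiber : M

namespace CocycleExtension

variable (z : cocycles₂ (Rep.trivial k Q M))

/-- The central extension defined by a normalized cocycle. -/
@[reducible] def group (hz : z.1 (1, 1) = 0) : Group (CocycleExtension z) :=
  letI : Mul (CocycleExtension z) :=
    -- With this sign the fiber coordinate itself is a cochain with coboundary `z`.
    ⟨fun a b => ⟨a.base * b.base, a.fiber + b.fiber - z.1 (a.base, b.base)⟩⟩
  letI : One (CocycleExtension z) := ⟨⟨1, 0⟩⟩
  letI : Inv (CocycleExtension z) := ⟨fun a => ⟨a.base⁻¹, z.1 (a.base⁻¹, a.base) - a.fiber⟩⟩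
  Group.ofLeftAxioms
    (fun a b c => by
      refine CocycleExtension.ext (mul_assoc _ _ _) ?_
      change a.fiber + b.fiber - z.1 (a.base, b.base) + c.fiber - z.1 (a.base * b.base, c.base) =
        a.fiber + (b.fiber + c.fiber - z.1 (b.base, c.base)) - z.1 (a.base, b.base * c.base)
      have := mem_cocycles₂_trivial_iff.1 z.2 a.base b.base c.base
      rw [← eq_sub_iff_add_eq] at this
      rw [this]
      abel)
    (fun a => by
      refine CocycleExtension.ext (one_mul _) ?_
      change 0 + a.fiber - z.1 (1, a.base) = a.fiber
      rw [show z.1 (1, a.base) = z.1 (1, 1) from cocycles₂_map_one_fst z _, hz]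
      abel)
    (fun a => by
      refine CocycleExtension.ext (inv_mul_cancel _) ?_
      change z.1 (a.base⁻¹, a.base) - a.fiber + a.fiber - z.1 (a.base⁻¹, a.base) = 0
      abel)

end CocycleExtension

/-- The second cohomology of `Q` is killed by inflation to the free group on `Q`. -/
theorem exists_isInflationCochain_freeGroup (a : groupCohomology (Rep.trivial k Q M) 2) :
    ∃ l, IsInflationCochain (FreeGroup.lift (id : Q → Q)) l a := by
  obtain ⟨z, hz, rfl⟩ := exists_normalized_cocycle₂ a
  let := CocycleExtension.group z hz
  let f : FreeGroup Q →* CocycleExtension z := FreeGroup.lift fun q => ⟨q, 0⟩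
  let p : CocycleExtension z →* Q := ⟨⟨CocycleExtension.base, rfl⟩, fun _ _ => rfl⟩
  have hp : p.comp f = FreeGroup.lift (id : Q → Q) := FreeGroup.ext_hom _ _ fun q => by simp [f, p]
  refine ⟨fun x => (f x).fiber, z, hz, rfl, fun x y => ?_⟩
  rw [← hp]
  beta_reduce
  rw [map_mul f]
  change z.1 ((f x).base, (f y).base) = _ - (_ + _ - z.1 ((f x).base, (f y).base))
  abel

end TrivialCoefficients

/-- A `ℚ/ℤ`-valued character of a subgroup that kills the commutators of the ambient group
extends to the ambient group. -/
theorem exists_monoidHom_extension_of_commutator_le {P : Type*} [Group P] (R : Subgroup P)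
    (f : R →* Multiplicative RatModInt.{u}) (hf : ∀ r : R, (r : P) ∈ commutator P → f r = 1) :
    ∃ χ : P →* Multiplicative RatModInt.{u}, ∀ r : R, χ r = f r := by
  let j : R →* Abelianization P := Abelianization.of.comp R.subtype
  -- The kernel of `j` is `R ∩ [P, P]`, so `f` descends to the image of `R` in the abelianization,
  -- from which injectivity of `ℚ/ℤ` extends it.
  have hj : j.rangeRestrict.ker ≤ f.ker := by
    intro r hr
    rw [MonoidHom.ker_rangeRestrict, MonoidHom.mem_ker] at hr
    refine hf r ?_
    rw [← Abelianization.ker_of, MonoidHom.mem_ker]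
    exact hr
  let s := Function.surjInv j.rangeRestrict_surjective
  have hs : Function.RightInverse s j.rangeRestrict := Function.surjInv_eq _
  let g := j.rangeRestrict.liftOfRightInverse s hs ⟨f, hj⟩
  have hg (r : R) : g (j.rangeRestrict r) = f r :=
    j.rangeRestrict.liftOfRightInverse_comp_apply s hs ⟨f, hj⟩ r
  let down : RatModInt.{u} →+ AddCircle (1 : ℚ) := AddEquiv.ulift.toAddMonoidHom
  let i : Additive j.range →ₗ[ℤ] Additive (Abelianization P) :=
    (MonoidHom.toAdditive j.range.subtype).toIntLinearMap
  obtain ⟨c, hc⟩ := CharacterModule.dual_surjective_of_injective i Subtype.val_injective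
    (down.comp (MonoidHom.toAdditiveLeft g) : Additive j.range →+ AddCircle (1 : ℚ))
  let up : AddCircle (1 : ℚ) →+ RatModInt.{u} := AddEquiv.ulift.symm.toAddMonoidHom
  let c' : Additive (Abelianization P) →+ AddCircle (1 : ℚ) := c
  refine ⟨(AddMonoidHom.toMultiplicativeRight (up.comp c')).comp Abelianization.of, fun r => ?_⟩
  have h : c' (Additive.ofMul (j r)) = down (g (j.rangeRestrict r)).toAdd :=
    DFunLike.congr_fun hc (Additive.ofMul (j.rangeRestrict r))
  rw [hg] at h
  exact congrArg (fun t => Multiplicative.ofAdd (up t)) h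

/-! ### Conjugation lifted to the free group, and the induction -/

section PresentationFiltration

variable {G : Type u} [Group G] (Q : Subgroup G)

/-- The preimages in the free group on `Q` of the iterated commutator subgroups `[Q, ᵢ G]`. -/
def freeCommutatorSeries (i : ℕ) : Subgroup (FreeGroup Q) :=
  (iterCommutator Q ⊤ i).comap (Q.subtype.comp (FreeGroup.lift id))

theorem freeCommutatorSeries_zero : freeCommutatorSeries Q 0 = ⊤ :=
  eq_top_iff.2 fun x _ => (FreeGroup.lift (id : Q → Q) x).2

variable [Q.Normal]

theorem freeCommutatorSeries_normal (i : ℕ) : (freeCommutatorSeries Q i).Normal :=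
  inferInstanceAs ((iterCommutator Q ⊤ i).comap _).Normal

theorem freeCommutatorSeries_antitone : Antitone (freeCommutatorSeries Q) :=
  antitone_nat_of_succ_le fun i => Subgroup.comap_mono
    (Subgroup.commutator_le_left (iterCommutator Q ⊤ i) ⊤)

/-- The automorphism of the free group on `Q` induced by conjugation by `g`. -/
def freeConj (g : G) : FreeGroup Q →* FreeGroup Q :=
  FreeGroup.map (MulAut.conjNormal (H := Q) g)

theorem lift_freeConj (g : G) (x : FreeGroup Q) :
    FreeGroup.lift (id : Q → Q) (freeConj Q g x) =
      MulAut.conjNormal g (FreeGroup.lift (id : Q → Q) x) := by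
  have : (FreeGroup.lift (id : Q → Q)).comp (freeConj Q g) =
      (MulAut.conjNormal g).toMonoidHom.comp (FreeGroup.lift (id : Q → Q)) :=
    FreeGroup.ext_hom _ _ fun q => by simp [freeConj]
  exact DFunLike.congr_fun this x

/-- In `G` the element in question becomes the commutator `⁅x⁻¹, g⁆`. -/
theorem inv_mul_freeConj_mem (g : G) (i : ℕ) {x : FreeGroup Q}
    (hx : x ∈ freeCommutatorSeries Q i) :
    x⁻¹ * freeConj Q g x ∈ freeCommutatorSeries Q (i + 1) := by
  have hx' : (FreeGroup.lift (id : Q → Q) x : G) ∈ iterCommutator Q ⊤ i := hx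
  have h := Subgroup.commutator_mem_commutator (inv_mem hx') (Subgroup.mem_top g)
  change ((FreeGroup.lift (id : Q → Q) (x⁻¹ * freeConj Q g x) : Q) : G) ∈
    iterCommutator Q ⊤ (i + 1)
  rw [map_mul, map_inv, lift_freeConj, Subgroup.coe_mul, MulAut.conjNormal_apply]
  simpa [iterCommutator, commutatorElement_def, mul_assoc] using h

theorem commutator_mem_ker_of_iterCommutator_eq_bot {c i j : ℕ} (h : iterCommutator Q ⊤ c = ⊥)
    (hij : i + j + 1 = c) {x y : FreeGroup Q} (hx : x ∈ freeCommutatorSeries Q i)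
    (hy : y ∈ freeCommutatorSeries Q j) : ⁅x, y⁆ ∈ (FreeGroup.lift (id : Q → Q)).ker := by
  have := commutator_iterCommutator_le Q i j (Subgroup.commutator_mem_commutator hx hy)
  rw [hij, h, Subgroup.mem_bot, ← map_commutatorElement] at this
  exact Subtype.ext this

variable {k : Type u} [CommRing k] {M : Type u} [AddCommGroup M] [Module k M]

/-- Each commutation with `G` lowers by one the filtration degree on which a suitable cochain
vanishes. -/
theorem exists_isInflationCochain_of_mem_iterModuleCommutator {c : ℕ}
    (hQ : iterCommutator Q ⊤ c = ⊥) (n m : ℕ) (h : n + m + 1 = c)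
    (a : Sha 2 (Rep.trivial k Q M))
    (ha : a ∈ iterModuleCommutator
      (shaRightRep (k := k) (Q := Q) M (MulAut.conjNormal (H := Q)) 2) n) :
    ∃ l : FreeGroup Q → M, IsInflationCochain (FreeGroup.lift (id : Q → Q)) l a.1 ∧
      ∀ w ∈ (FreeGroup.lift (id : Q → Q)).ker,
        w ∈ commutatorFiltration (freeCommutatorSeries Q) m → l w = 0 := by
  induction n generalizing m a with
  | zero =>
    obtain ⟨l, hl⟩ := exists_isInflationCochain_freeGroup a.1
    refine ⟨l, hl, fun w _ hw => ?_⟩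
    -- Here `m = c - 1`, so each generating commutator already lies in the kernel, where `l` is a
    -- homomorphism killing it.
    have : commutatorFiltration (freeCommutatorSeries Q) m ≤
        hl.kerHom.ker.map (FreeGroup.lift (id : Q → Q)).ker.subtype := by
      refine (Subgroup.closure_le _).2 ?_
      rintro _ ⟨i, j, hij, x, hx, y, hy, rfl⟩
      have hxy := commutator_mem_ker_of_iterCommutator_eq_bot Q hQ (by omega) hx hy
      exact ⟨⟨_, hxy⟩, hl.commutator_eq_zero a.2 hxy, rfl⟩
    obtain ⟨r, hr, rfl⟩ := this hw
    exact hr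
  | succ n ih =>
    induction ha using AddSubgroup.closure_induction with
    | mem a ha =>
      obtain ⟨v, hv, g, rfl⟩ := ha
      obtain ⟨l, hl, hl'⟩ := ih (m + 1) (by omega) v hv
      have hg := hl.pullback (MulAut.conjNormal g.unop).toMonoidHom (freeConj Q g.unop)
        (lift_freeConj Q g.unop)
      refine ⟨l ∘ freeConj Q g.unop + -l, ?_, fun w hw hw' => ?_⟩
      · rw [sub_eq_add_neg]
        exact hg.add hl.neg
      · have hgw : freeConj Q g.unop w ∈ (FreeGroup.lift (id : Q → Q)).ker := by
          rw [MonoidHom.mem_ker, lift_freeConj, MonoidHom.mem_ker.1 hw, map_one]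
        -- On the kernel, `l (g w) - l w = l (g w * w⁻¹)`, and `g w * w⁻¹` has degree `m + 1`.
        have := hl' _ (mul_mem hgw (inv_mem hw))
          (map_mul_inv_mem_commutatorFiltration (freeCommutatorSeries_normal Q)
            (freeCommutatorSeries_antitone Q) (freeConj Q g.unop)
            (fun i _ => inv_mul_freeConj_mem Q g.unop i) hw')
        rw [← div_eq_mul_inv, hl.map_div_of_mem_ker hgw hw] at this
        rwa [Pi.add_apply, Pi.neg_apply, ← sub_eq_add_neg]
    | zero => exact ⟨0, .zero _, fun _ _ _ => rfl⟩
    | add a b _ _ ha hb =>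
      obtain ⟨l, hl, hl'⟩ := ha
      obtain ⟨l', hb, hb'⟩ := hb
      exact ⟨l + l', hl.add hb, fun w hw hw' => by
        rw [Pi.add_apply, hl' w hw hw', hb' w hw hw', add_zero]⟩
    | neg a _ ha =>
      obtain ⟨l, hl, hl'⟩ := ha
      exact ⟨-l, hl.neg, fun w hw hw' => by rw [Pi.neg_apply, hl' w hw hw', neg_zero]⟩

end PresentationFiltration

theorem mainTheorem3 {G : Type u} [Group G] [Finite G] (Q : Subgroup G) [Q.Normal]
    (c : ℕ) (hc : 1 ≤ c) (hQ : iterCommutator Q ⊤ c = ⊥) :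
    iterModuleCommutator
      (shaRightRep (k := LiftedInt.{u}) (Q := Q) RatModInt.{u} (MulAut.conjNormal (H := Q)) 2)
      (c - 1) = ⊥ := by
  rw [eq_bot_iff]
  intro a ha
  obtain ⟨l, hl, hl'⟩ := exists_isInflationCochain_of_mem_iterModuleCommutator Q hQ (c - 1) 0
    (by omega) a ha
  obtain ⟨χ, hχ⟩ := exists_monoidHom_extension_of_commutator_le _ hl.kerHom fun r hr =>
    hl' r r.2 (commutator_le_commutatorFiltration_zero (freeCommutatorSeries_zero Q) hr)
  refine Subtype.ext (hl.eq_zero_of_extends (fun q => ⟨FreeGroup.of q, by simp⟩) χ ?_)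
  exact fun r hr => congrArg Multiplicative.toAdd (hχ ⟨r, hr⟩)
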